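/- Consider the random-to-random transposition shuffle of a deck of $n$ cards: at every step two locations $L_t,R_t$ are chosen independently and uniformly from the $n$ locations (independently of the past), and the cards at these two locations are switched. For a set $C$ of cards let $$d_C(t)=\max_{\sigma_0}\|\mu_C^{\sigma_t}-\mu_C^{\pi}\|_{\mathrm{TV}},$$ where $\mu_C^{\sigma_t}$ is the joint law of the locations of the cards of $C$ after $t$ steps started from the deck $\sigma_0$, and $\mu_C^{\pi}$ is their joint law in a uniformly random deck. For $k=k(n)$ put $D_n(t)=\max_{|C|=k}d_C(t)$, where for real $t$ the deck at time $t$ is the deck after $\lfloor t\rfloor$ steps (the initial deck if $t<0$). The shuffle has $k$-partial cutoff at time $t_{\mathrm{mix}}=t_{\mathrm{mix}}(n)$ with a window of size $\omega=\omega(n)=o(t_{\mathrm{mix}})$ if $$\lim_{\alpha\to\infty}\limsup_{n\to\infty}D_n(t_{\mathrm{mix}}+\alpha\omega)=0\quad\text{and}\quad\lim_{\alpha\to-\infty}\liminf_{n\to\infty}D_n(t_{\mathrm{mix}}+\alpha\omega)=1.$$ (1) If $k=o((n/\log n)^{1/2})$ and $k\to\infty$ as $n\to\infty$, then the random-to-random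 transposition shuffle has $k$-partial cutoff at time $\tfrac12 n\log k$ with a window of size $\omega(n)=n$ (in particular, of size $O(n)$). (2) If there is a constant $K$ with $k(n)<K$ for all $n$, then there is no cutoff: there are no $t_{\mathrm{mix}}$ and $\omega=o(t_{\mathrm{mix}})$ for which the shuffle has $k$-partial cutoff at time $t_{\mathrm{mix}}$ with a window of size $\omega$. (3) For every $n\ge1$, every single card $i$ and every integer $t\ge0$, $d_{\{i\}}(t)\le e^{-2t(1-2/n)/n}$. -/

import Mathlib

open Filter Topology Asymptotics

noncomputable section

namespace CardShuffle

/-- Total variation distance between two probability distributions on a finite set. -/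
def tvDist {α : Type*} [Fintype α] (μ ν : PMF α) : ℝ :=
  (1 / 2) * ∑ a, |(μ a).toReal - (ν a).toReal|

/-- One step of a semi-random transposition shuffle. A deck is a permutation `σ` with `σ j` the
card at location `j`. The left hand picks a location with law `ℓ`, the right hand independently
picks a uniform location, and the cards at these two locations switch places. -/
def step {n : ℕ} [NeZero n] (ℓ : PMF (Fin n)) (σ : Equiv.Perm (Fin n)) :
    PMF (Equiv.Perm (Fin n)) :=
  ℓ.bind fun l => (PMF.uniformOfFintype (Fin n)).map fun r => σ * Equiv.swap l r

/-- The law of the deck at time `t`, started from `σ₀`, when at every time `s` the left hand picks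
a location with law `ℓ s`, independently of everything else. -/
def deckLaw {n : ℕ} [NeZero n] (ℓ : ℕ → PMF (Fin n)) (σ₀ : Equiv.Perm (Fin n)) :
    ℕ → PMF (Equiv.Perm (Fin n))
  | 0 => PMF.pure σ₀
  | t + 1 => (deckLaw ℓ σ₀ t).bind (step (ℓ (t + 1)))

/-- The joint law of the locations of the cards in `C`, for a random deck with law `μ`. -/
def locationLaw {n : ℕ} (C : Finset (Fin n)) (μ : PMF (Equiv.Perm (Fin n))) : PMF (C → Fin n) :=
  μ.map fun σ c => σ⁻¹ (c : Fin n)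

/-- `d_C(t)`: the distance at time `t` between the joint law of the locations of the cards in `C`
and their joint law in a uniform permutation, maximised over the initial deck. -/
def cardDist {n : ℕ} [NeZero n] (ℓ : ℕ → PMF (Fin n)) (C : Finset (Fin n)) (t : ℕ) : ℝ :=
  ⨆ σ₀ : Equiv.Perm (Fin n),
    tvDist (locationLaw C (deckLaw ℓ σ₀ t))
      (locationLaw C (PMF.uniformOfFintype (Equiv.Perm (Fin n))))

/-- The maximum of `d_C(t)` over all sets `C` of `k` cards. -/
def partialDist {n : ℕ} [NeZero n] (ℓ : ℕ → PMF (Fin n)) (k t : ℕ) : ℝ :=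
  ⨆ C : {C : Finset (Fin n) // C.card = k}, cardDist ℓ C.1 t

/-- A semi-random transposition shuffle, for every nonempty deck: the law of the left hand's choice
as a function of the deck size and of time. -/
abbrev Shuffle : Type := (n : ℕ) → [NeZero n] → ℕ → PMF (Fin n)

/-- The random-to-random transposition shuffle: the left hand is uniform as well. -/
def randomToRandom : Shuffle := fun n _ _ => PMF.uniformOfFintype (Fin n)

/-- `partialDist` for the deck of size `n`, at a real time `s`: the deck at time `s` is the deck
after `⌊s⌋` steps, and the initial deck if `s < 0`. The value for the empty deck is immaterial. -/
def distAt (S : Shuffle) (n k : ℕ) (s : ℝ) : ℝ :=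
  if h : n = 0 then 0
  else
    haveI : NeZero n := ⟨h⟩
    partialDist (S n) k ⌊s⌋₊

/-- `k`-partial cutoff at time `tmix` with a window of size `ω`. -/
structure HasPartialCutoff (S : Shuffle) (k : ℕ → ℕ) (tmix ω : ℕ → ℝ) : Prop where
  window : ω =o[atTop] tmix
  after : Tendsto
    (fun α : ℝ => limsup (fun n : ℕ => distAt S n (k n) (tmix n + α * ω n)) atTop) atTop (𝓝 0)
  before : Tendsto
    (fun α : ℝ => liminf (fun n : ℕ => distAt S n (k n) (tmix n + α * ω n)) atTop) atBot (𝓝 1)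

end CardShuffle

end

/-
For a location `u`, a function of the card at `u` is, after one step, `1 - 2 / n` times itself plus
`2 / n` times its mean, and likewise for the location of a given card. Iterating bounds `d_{i}`.

Upper bound: any two decks can be made to agree on the locations of the cards of `C` by changing at
most `2 |C|` places. If the hands of the second deck move along with this change, the two decks
keep differing in the same places, so the locations of `C` differ only when a card of `C` sits in
one of them. By the first paragraph this costs at most `2 k (|1 - 2 / n| ^ t + k / n)`.

Lower bound: a card of `C` at its initial location betrays a deck that is not yet mixed, since in a
uniform deck such a card exists with probability at most `k / n`. In the shuffled deck it exists as
soon as some card of `C` is untouched, and the binomial moments of the number of untouched cards are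
explicit, so the second moment method applies.

If `k` is bounded along a subsequence, both bounds at time `T * n` decay exponentially in `T`,
so the distance changes gradually on the scale `n` and not within a window that is negligible
compared to the mixing time.
-/

namespace CardShuffle

open Equiv Equiv.Perm
open scoped BigOperators

section TotalVariation

variable {α β : Type*} [Fintype α] [Fintype β]

/-- The expectation of `f` under a distribution `μ` on a finite type, as a finite sum rather than
an integral so that no measurable structure on `α` is needed. -/
noncomputable def expectation (μ : PMF α) (f : α → ℝ) : ℝ :=
  ∑ a, (μ a).toReal * f a

theorem sum_toReal_eq_one (μ : PMF α) : ∑ a, (μ a).toReal = 1 := by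
  rw [← ENNReal.toReal_sum fun a _ => μ.apply_ne_top a, ← tsum_fintype (L := .unconditional α),
    μ.tsum_coe, ENNReal.toReal_one]

theorem expectation_pure (a : α) (f : α → ℝ) : expectation (PMF.pure a) f = f a := by
  classical
  rw [expectation, Finset.sum_eq_single a] <;> simp +contextual [PMF.pure_apply]

theorem expectation_bind (μ : PMF α) (κ : α → PMF β) (f : β → ℝ) :
    expectation (μ.bind κ) f = expectation μ fun a => expectation (κ a) f := by
  have toReal_bind (b : β) : ((μ.bind κ) b).toReal = ∑ a, (μ a).toReal * (κ a b).toReal := by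
    rw [PMF.bind_apply, tsum_fintype, ENNReal.toReal_sum fun a _ =>
      ENNReal.mul_ne_top (μ.apply_ne_top a) ((κ a).apply_ne_top b)]
    simp only [ENNReal.toReal_mul]
  simp only [expectation, toReal_bind, Finset.sum_mul, Finset.mul_sum, mul_assoc]
  exact Finset.sum_comm

theorem expectation_map (μ : PMF α) (g : α → β) (f : β → ℝ) :
    expectation (μ.map g) f = expectation μ fun a => f (g a) := by
  simp only [PMF.map, expectation_bind, Function.comp_apply, expectation_pure]

theorem expectation_uniformOfFintype [Nonempty α] (f : α → ℝ) :
    expectation (PMF.uniformOfFintype α) f = 𝔼 a, f a := by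
  simp [expectation, ← Finset.mul_sum, Fintype.expect_eq_sum_div_card, div_eq_inv_mul]

theorem tvDist_nonneg (μ ν : PMF α) : 0 ≤ tvDist μ ν := by
  unfold tvDist
  positivity

theorem tvDist_le_one (μ ν : PMF α) : tvDist μ ν ≤ 1 := by
  have h : ∑ a, |(μ a).toReal - (ν a).toReal| ≤ ∑ a, ((μ a).toReal + (ν a).toReal) :=
    Finset.sum_le_sum fun a _ => (abs_sub _ _).trans_eq <| by simp
  rw [Finset.sum_add_distrib, sum_toReal_eq_one, sum_toReal_eq_one] at h
  rw [tvDist]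
  linarith

theorem tvDist_le_of_forall_expectation_sub_le {μ ν : PMF α} {B : ℝ}
    (h : ∀ f : α → ℝ, (∀ a, |f a| ≤ 1) → expectation μ f - expectation ν f ≤ 2 * B) :
    tvDist μ ν ≤ B := by
  have abs_sign_le (x : ℝ) : |(SignType.sign x : ℝ)| ≤ 1 := by
    rcases lt_trichotomy x 0 with hx | rfl | hx <;> simp [*]
  have hsign := h (fun a => SignType.sign ((μ a).toReal - (ν a).toReal)) fun a => abs_sign_le _
  rw [expectation, expectation, ← Finset.sum_sub_distrib] at hsign
  simp only [← sub_mul, self_mul_sign] at hsign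
  rw [tvDist]
  linarith

theorem expectation_sub_le_tvDist (μ ν : PMF α) {f : α → ℝ} (h0 : ∀ a, 0 ≤ f a)
    (h1 : ∀ a, f a ≤ 1) : expectation μ f - expectation ν f ≤ tvDist μ ν := by
  have recenter : expectation μ f - expectation ν f
      = ∑ a, ((μ a).toReal - (ν a).toReal) * (f a - 1 / 2) := by
    simp only [expectation, sub_mul, mul_sub, Finset.sum_sub_distrib, ← Finset.sum_mul,
      sum_toReal_eq_one]
    ring
  rw [recenter, tvDist, Finset.mul_sum]
  refine Finset.sum_le_sum fun a _ => (le_abs_self _).trans ?_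
  rw [abs_mul, mul_comm]
  have : |f a - 1 / 2| ≤ 1 / 2 := abs_le.2 ⟨by linarith [h0 a], by linarith [h1 a]⟩
  gcongr

end TotalVariation

section RandomMap

variable {ι κ X Y : Type*} [Fintype ι] [Fintype κ]

/-- The transition operator of the Markov chain that moves from `x` to `φ i x`, where `i` is
uniform: it sends `f` to the expectation of `f` after one step, as a function of the start. -/
noncomputable def randomMapOp (φ : ι → X → X) : Module.End ℝ (X → ℝ) where
  toFun f x := 𝔼 i, f (φ i x)
  map_add' _ _ := funext fun _ => Finset.expect_add_distrib _ _ _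
  map_smul' c _ := funext fun _ => (Finset.smul_expect c _ _).symm

theorem randomMapOp_apply (φ : ι → X → X) (f : X → ℝ) (x : X) :
    randomMapOp φ f x = 𝔼 i, f (φ i x) :=
  rfl

theorem randomMapOp_const [Nonempty ι] (φ : ι → X → X) (c : ℝ) :
    randomMapOp φ (fun _ => c) = fun _ => c :=
  funext fun _ => Fintype.expect_const c

theorem randomMapOp_pow_le_of_coupling {φ : ι → X → X} {ψ : κ → Y → Y} (e : ι ≃ κ)
    {R : X → Y → Prop} (hR : ∀ {x y}, R x y → ∀ i, R (φ i x) (ψ (e i) y)) {f : X → ℝ}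
    {g : Y → ℝ} (hfg : ∀ {x y}, R x y → f x ≤ g y) (t : ℕ) {x : X} {y : Y} (hxy : R x y) :
    (randomMapOp φ ^ t) f x ≤ (randomMapOp ψ ^ t) g y := by
  induction t generalizing x y with
  | zero => exact hfg hxy
  | succ t ih =>
    rw [pow_succ', pow_succ', Module.End.mul_apply, Module.End.mul_apply, randomMapOp_apply,
      randomMapOp_apply, ← Fintype.expect_equiv e _ _ fun _ => rfl]
    exact Finset.expect_le_expect fun i _ => ih (hR hxy i)

theorem pow_apply_eq_of_apply_eq {R M : Type*} [CommRing R] [AddCommGroup M] [Module R M]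
    {P : Module.End R M} {f m : M} {c : R} (hf : P f = c • f + (1 - c) • m) (hm : P m = m)
    (t : ℕ) : (P ^ t) f = c ^ t • f + (1 - c ^ t) • m := by
  induction t with
  | zero => simp
  | succ t ih =>
    rw [pow_succ', Module.End.mul_apply, ih, map_add, map_smul, map_smul, hf, hm]
    module

end RandomMap

section Transpositions

variable {α : Type*} [Fintype α] [DecidableEq α]

theorem expect_swap_apply (h : α → ℝ) (u : α) :
    𝔼 i : α × α, h (swap i.1 i.2 u)
      = (1 - 2 / Fintype.card α) * h u + 2 / Fintype.card α * 𝔼 v, h v := by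
  have : Nonempty α := ⟨u⟩
  have swap_eq (l r : α) : h (swap l r u)
      = h u + ((if l = u then h r - h u else 0) + if r = u then h l - h u else 0) := by
    rcases eq_or_ne l u with rfl | hl
    · by_cases hr : r = l <;> simp [hr]
    · rcases eq_or_ne r u with rfl | hr
      · simp [hl]
      · simp [swap_apply_of_ne_of_ne hl.symm hr.symm, hl, hr]
  have ite_left (l : α) : 𝔼 r, (if l = u then h r - h u else 0)
      = if l = u then 𝔼 r, h r - h u else 0 := by
    split_ifs <;> simp [Finset.expect_sub_distrib]
  have expect_ite (x : ℝ) : 𝔼 v, (if v = u then x else 0) = x / Fintype.card α := by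
    simp only [Fintype.expect_eq_sum_div_card, Finset.sum_ite_eq', Finset.mem_univ, if_true]
  rw [← Finset.univ_product_univ, Finset.expect_product]
  simp only [swap_eq, Finset.expect_add_distrib, Fintype.expect_const, ite_left, expect_ite,
    ← Finset.expect_div, Finset.expect_sub_distrib]
  ring

theorem expect_perm_inv_apply (g : α → ℝ) (c : α) : 𝔼 σ : Perm α, g (σ⁻¹ c) = 𝔼 u, g u := by
  have : Nonempty α := ⟨c⟩
  have indep (a : α) : 𝔼 σ : Perm α, g (σ⁻¹ a) = 𝔼 σ : Perm α, g (σ⁻¹ c) :=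
    Fintype.expect_equiv (Equiv.mulLeft (swap a c)) _ _ fun σ => by simp
  calc 𝔼 σ : Perm α, g (σ⁻¹ c) = 𝔼 a, 𝔼 σ : Perm α, g (σ⁻¹ a) := by
        simp only [indep, Fintype.expect_const]
    _ = 𝔼 σ : Perm α, 𝔼 a, g (σ⁻¹ a) := Finset.expect_comm _ _ _
    _ = 𝔼 _σ : Perm α, 𝔼 u, g u := by
        congr! 1 with σ
        exact Fintype.expect_equiv σ⁻¹ _ _ fun _ => rfl
    _ = 𝔼 u, g u := Fintype.expect_const _

theorem exists_card_support_le_mul_inv_eqOn (C : Finset α) (σ σ' : Perm α) :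
    ∃ ρ : Perm α, ρ.support.card ≤ 2 * C.card ∧ ∀ c ∈ C, (σ * ρ)⁻¹ c = σ'⁻¹ c := by
  induction C using Finset.induction_on with
  | empty => exact ⟨1, by simp, by simp⟩
  | insert a C ha ih =>
    obtain ⟨ρ, hcard, heq⟩ := ih
    set s := swap ((σ * ρ)⁻¹ a) (σ'⁻¹ a)
    have card_s : s.support.card ≤ 2 := by
      rcases eq_or_ne ((σ * ρ)⁻¹ a) (σ'⁻¹ a) with h | h
      · simp only [s, h, swap_self, support_refl, Finset.card_empty, zero_le]
      · exact (card_support_swap h).le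
    refine ⟨ρ * s, ?_, fun c hc => ?_⟩
    · calc (ρ * s).support.card ≤ ρ.support.card + s.support.card :=
            (Finset.card_le_card (support_mul_le ρ s)).trans (Finset.card_union_le _ _)
        _ ≤ 2 * C.card + 2 := add_le_add hcard card_s
        _ = 2 * (insert a C).card := by rw [Finset.card_insert_of_notMem ha]; ring
    · have : (σ * (ρ * s))⁻¹ c = s ((σ * ρ)⁻¹ c) := by simp [s, ← mul_assoc]
      rw [this]
      rcases Finset.mem_insert.1 hc with rfl | hc
      · exact swap_apply_left _ _
      · have hca : c ≠ a := ne_of_mem_of_not_mem hc ha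
        rw [swap_apply_of_ne_of_ne ((σ * ρ)⁻¹.injective.ne hca), heq c hc]
        rw [heq c hc]
        exact σ'⁻¹.injective.ne hca

end Transpositions

section Deck

variable {α : Type*} [Fintype α] [DecidableEq α]

/-- The transition operator of the random-to-random transposition shuffle. -/
noncomputable def deckOp (α : Type*) [Fintype α] [DecidableEq α] :
    Module.End ℝ (Perm α → ℝ) :=
  randomMapOp fun (i : α × α) σ => σ * swap i.1 i.2

theorem deckOp_pow_apply_location (g : α → ℝ) (u : α) (σ : Perm α) (t : ℕ) :
    (deckOp α ^ t) (fun τ => g (τ u)) σ = (1 - 2 / Fintype.card α : ℝ) ^ t * g (σ u)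
      + (1 - (1 - 2 / Fintype.card α : ℝ) ^ t) * 𝔼 c, g c := by
  have : Nonempty α := ⟨u⟩
  refine congr_fun (pow_apply_eq_of_apply_eq (m := fun _ => 𝔼 c, g c) (funext fun σ => ?_)
    (randomMapOp_const _ _) t) σ
  have mean : 𝔼 v, g (σ v) = 𝔼 c, g c := Fintype.expect_equiv σ _ _ fun _ => rfl
  simp only [randomMapOp_apply, Perm.mul_apply, expect_swap_apply (fun v => g (σ v)), mean,
    Pi.add_apply, Pi.smul_apply, smul_eq_mul, sub_sub_cancel]

theorem deckOp_pow_inv_apply_card (g : α → ℝ) (c : α) (σ : Perm α) (t : ℕ) :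
    (deckOp α ^ t) (fun τ => g (τ⁻¹ c)) σ = (1 - 2 / Fintype.card α : ℝ) ^ t * g (σ⁻¹ c)
      + (1 - (1 - 2 / Fintype.card α : ℝ) ^ t) * 𝔼 u, g u := by
  have : Nonempty α := ⟨c⟩
  refine congr_fun (pow_apply_eq_of_apply_eq (m := fun _ => 𝔼 u, g u) (funext fun σ => ?_)
    (randomMapOp_const _ _) t) σ
  simp only [randomMapOp_apply, mul_inv_rev, swap_inv, Perm.mul_apply, expect_swap_apply,
    Pi.add_apply, Pi.smul_apply, smul_eq_mul, sub_sub_cancel]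

/-- The locations of the cards in `C`, as a function of the deck. -/
def locations (C : Finset α) (σ : Perm α) : C → α :=
  fun c => σ⁻¹ (c : α)

theorem deckOp_pow_congr_locations {C : Finset α} (g : (C → α) → ℝ) (t : ℕ) {σ σ' : Perm α}
    (hσ : locations C σ = locations C σ') :
    (deckOp α ^ t) (fun τ => g (locations C τ)) σ
      = (deckOp α ^ t) (fun τ => g (locations C τ)) σ' := by
  have le {σ σ' : Perm α} (hσ : locations C σ = locations C σ') :
      (deckOp α ^ t) (fun τ => g (locations C τ)) σ
        ≤ (deckOp α ^ t) (fun τ => g (locations C τ)) σ' :=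
    randomMapOp_pow_le_of_coupling (Equiv.refl (α × α))
      (R := fun τ τ' => locations C τ = locations C τ')
      (fun {τ τ'} h i => funext fun c => by
        simpa only [locations, mul_inv_rev, swap_inv, Perm.mul_apply, Equiv.refl_apply] using
          congrArg (swap i.1 i.2) (congr_fun h c))
      (fun h => (congrArg g h).le) t hσ
  exact (le hσ).antisymm (le hσ.symm)

/-- Couple the two decks by moving the hands of the second one with `ρ⁻¹`. -/
theorem deckOp_pow_sub_mul_right_le {f h : Perm α → ℝ} {ρ : Perm α}
    (hfh : ∀ τ, f τ - f (τ * ρ) ≤ h τ) (σ : Perm α) (t : ℕ) :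
    (deckOp α ^ t) f σ - (deckOp α ^ t) f (σ * ρ) ≤ (deckOp α ^ t) h σ := by
  have coupled : (deckOp α ^ t) (f - h) σ ≤ (deckOp α ^ t) f (σ * ρ) :=
    randomMapOp_pow_le_of_coupling (Equiv.prodCongr ρ⁻¹ ρ⁻¹) (R := fun τ τ' => τ' = τ * ρ)
      (fun {τ _} hτ i => by
        rw [hτ, mul_assoc, mul_assoc, Equiv.mul_swap_eq_swap_mul]
        simp)
      (fun {τ _} hτ => by rw [hτ, Pi.sub_apply]; linarith [hfh τ]) t rfl
  rw [map_sub, Pi.sub_apply] at coupled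
  linarith

theorem sub_mul_right_le_sum_indicator {C : Finset α} {g : (C → α) → ℝ} (hg : ∀ x, |g x| ≤ 1)
    (ρ τ : Perm α) : g (locations C τ) - g (locations C (τ * ρ))
      ≤ 2 * ∑ u ∈ ρ.support, (C : Set α).indicator 1 (τ u) := by
  have nonneg (u : α) : (0 : ℝ) ≤ (C : Set α).indicator 1 (τ u) :=
    Set.indicator_nonneg (fun _ _ => zero_le_one) _
  by_cases hC : ∃ u ∈ ρ.support, τ u ∈ C
  · obtain ⟨u, hu, huC⟩ := hC
    have one_le : (1 : ℝ) ≤ ∑ u ∈ ρ.support, (C : Set α).indicator 1 (τ u) := by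
      simpa [huC] using Finset.single_le_sum (fun v _ => nonneg v) hu
    linarith [(abs_le.1 (hg (locations C τ))).2, (abs_le.1 (hg (locations C (τ * ρ)))).1]
  · push Not at hC
    have unmoved : locations C (τ * ρ) = locations C τ := funext fun c => by
      have hc : τ⁻¹ (c : α) ∉ ρ.support := fun hu => hC _ hu (by simp)
      rw [locations, locations, mul_inv_rev, Perm.mul_apply, Perm.inv_eq_iff_eq]
      exact (notMem_support.1 hc).symm
    rw [unmoved, sub_self]
    exact mul_nonneg zero_le_two (Finset.sum_nonneg fun u _ => nonneg u)

theorem deckOp_pow_indicator_le (C : Finset α) (u : α) (σ : Perm α) (t : ℕ) :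
    (deckOp α ^ t) (fun τ => (C : Set α).indicator 1 (τ u)) σ
      ≤ |(1 - 2 / Fintype.card α : ℝ)| ^ t + (C.card / Fintype.card α : ℝ) := by
  have mean : 𝔼 c, (C : Set α).indicator (1 : α → ℝ) c = C.card / Fintype.card α := by
    simp [Fintype.expect_eq_sum_div_card, Set.indicator_apply]
  have hq0 : (0 : ℝ) ≤ C.card / Fintype.card α := by positivity
  have hq1 : (C.card / Fintype.card α : ℝ) ≤ 1 :=
    div_le_one_of_le₀ (by exact_mod_cast C.card_le_univ) (Nat.cast_nonneg _)
  have hdev : |(C : Set α).indicator (1 : α → ℝ) (σ u) - C.card / Fintype.card α| ≤ 1 := by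
    rw [abs_le]
    by_cases h : σ u ∈ C <;> simp only [Set.indicator, Finset.mem_coe, h, if_true, if_false,
      Pi.one_apply] <;> constructor <;> linarith
  rw [deckOp_pow_apply_location, mean]
  calc _ = (1 - 2 / Fintype.card α : ℝ) ^ t
          * ((C : Set α).indicator 1 (σ u) - C.card / Fintype.card α)
          + C.card / Fintype.card α := by ring
    _ ≤ |(1 - 2 / Fintype.card α : ℝ) ^ t
          * ((C : Set α).indicator 1 (σ u) - C.card / Fintype.card α)|
          + C.card / Fintype.card α := add_le_add_left (le_abs_self _) _
    _ ≤ |(1 - 2 / Fintype.card α : ℝ)| ^ t + C.card / Fintype.card α := by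
        rw [abs_mul, abs_pow]
        gcongr
        exact mul_le_of_le_one_right (by positivity) hdev

theorem deckOp_pow_locations_sub_le {C : Finset α} {g : (C → α) → ℝ} (hg : ∀ x, |g x| ≤ 1)
    (σ σ' : Perm α) (t : ℕ) :
    (deckOp α ^ t) (fun τ => g (locations C τ)) σ - (deckOp α ^ t) (fun τ => g (locations C τ)) σ'
      ≤ 4 * C.card * (|(1 - 2 / Fintype.card α : ℝ)| ^ t + C.card / Fintype.card α) := by
  obtain ⟨ρ, hρ, hloc⟩ := exists_card_support_le_mul_inv_eqOn C σ σ'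
  have card_le : (ρ.support.card : ℝ) ≤ 2 * C.card := by exact_mod_cast hρ
  rw [← deckOp_pow_congr_locations g t (σ := σ * ρ) (funext fun c => hloc c c.2)]
  calc _ ≤ (deckOp α ^ t)
          (fun τ => 2 * ∑ u ∈ ρ.support, (C : Set α).indicator 1 (τ u)) σ :=
        deckOp_pow_sub_mul_right_le (sub_mul_right_le_sum_indicator hg ρ) σ t
    _ = (deckOp α ^ t)
          ((2 : ℝ) • ∑ u ∈ ρ.support, fun τ => (C : Set α).indicator 1 (τ u)) σ := by
        congr! 1
        ext τ
        simp
    _ = 2 * ∑ u ∈ ρ.support, (deckOp α ^ t) (fun τ => (C : Set α).indicator 1 (τ u)) σ := by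
        simp
    _ ≤ 2 * ∑ _u ∈ ρ.support,
          (|(1 - 2 / Fintype.card α : ℝ)| ^ t + (C.card / Fintype.card α : ℝ)) := by
        gcongr
        exact deckOp_pow_indicator_le C _ σ t
    _ = 2 * (ρ.support.card * (|(1 - 2 / Fintype.card α : ℝ)| ^ t + C.card / Fintype.card α)) := by
        rw [Finset.sum_const, nsmul_eq_mul]
    _ ≤ 2 * (2 * C.card * (|(1 - 2 / Fintype.card α : ℝ)| ^ t + C.card / Fintype.card α)) := by
        gcongr
    _ = _ := by ring

end Deck

section SomeFixed

variable {α : Type*} [DecidableEq α]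

/-- The indicator of the event that a card of `C` is at the location with its own label. -/
noncomputable def someFixed (C : Finset α) (x : C → α) : ℝ :=
  if ∃ c, x c = c then 1 else 0

theorem someFixed_nonneg (C : Finset α) (x : C → α) : 0 ≤ someFixed C x := by
  unfold someFixed
  split_ifs <;> norm_num

theorem someFixed_le_one (C : Finset α) (x : C → α) : someFixed C x ≤ 1 := by
  unfold someFixed
  split_ifs <;> norm_num

theorem someFixed_le_sum (C : Finset α) (x : C → α) :
    someFixed C x ≤ ∑ c, if x c = c then 1 else 0 := by
  have nonneg (c : C) : (0 : ℝ) ≤ if x c = c then 1 else 0 := by positivity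
  unfold someFixed
  split_ifs with h
  · obtain ⟨c, hc⟩ := h
    simpa only [if_pos hc] using Finset.single_le_sum (fun d _ => nonneg d) (Finset.mem_univ c)
  · exact Finset.sum_nonneg fun d _ => nonneg d

theorem expect_someFixed_le [Fintype α] (C : Finset α) :
    𝔼 σ : Perm α, someFixed C (locations C σ) ≤ C.card / Fintype.card α := by
  have single (c : C) : 𝔼 σ : Perm α, (if locations C σ c = c then (1 : ℝ) else 0)
      = 1 / Fintype.card α := by
    refine (expect_perm_inv_apply (fun u => if u = (c : α) then (1 : ℝ) else 0) c).trans ?_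
    simp only [Fintype.expect_eq_sum_div_card, Finset.sum_ite_eq', Finset.mem_univ, if_true]
  calc 𝔼 σ : Perm α, someFixed C (locations C σ)
      ≤ 𝔼 σ : Perm α, ∑ c, if locations C σ c = c then (1 : ℝ) else 0 :=
        Finset.expect_le_expect fun σ _ => someFixed_le_sum C _
    _ = C.card / Fintype.card α := by
        rw [Finset.expect_sum_comm]
        simp only [single, Finset.sum_const, Finset.card_univ, Fintype.card_coe, nsmul_eq_mul,
          mul_one_div]

end SomeFixed

section Untouched

variable {α : Type*} [Fintype α] [DecidableEq α]

/-- The transition operator of the set of cards not yet touched, when the cards are labelled by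
their initial locations: the two hands remove the cards `i.1` and `i.2`. -/
noncomputable def untouchedOp (α : Type*) [Fintype α] [DecidableEq α] :
    Module.End ℝ (Finset α → ℝ) :=
  randomMapOp fun (i : α × α) A => A \ {i.1, i.2}

theorem expect_ite_notMem_and_notMem [Nonempty α] (S : Finset α) :
    𝔼 i : α × α, (if i.1 ∉ S ∧ i.2 ∉ S then (1 : ℝ) else 0)
      = (1 - S.card / Fintype.card α) ^ 2 := by
  have single : 𝔼 l : α, (if l ∉ S then (1 : ℝ) else 0) = 1 - S.card / Fintype.card α := by
    have (l : α) : (if l ∉ S then (1 : ℝ) else 0) = 1 - if l ∈ S then 1 else 0 := by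
      split_ifs <;> simp_all
    simp only [this, Finset.expect_sub_distrib, Fintype.expect_const]
    simp [Fintype.expect_eq_sum_div_card]
  rw [sq, ← single, Finset.expect_mul_expect, ← Finset.univ_product_univ, Finset.expect_product]
  congr! 2
  split_ifs <;> simp_all

theorem untouchedOp_choose_card [Nonempty α] (j : ℕ) :
    untouchedOp α (fun A => (A.card.choose j : ℝ))
      = ((1 - j / Fintype.card α : ℝ) ^ 2) • fun A => (A.card.choose j : ℝ) := by
  funext A
  have choose_eq_sum (i : α × α) : (((A \ {i.1, i.2}).card.choose j : ℕ) : ℝ)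
      = ∑ S ∈ A.powersetCard j, if i.1 ∉ S ∧ i.2 ∉ S then (1 : ℝ) else 0 := by
    rw [Finset.sum_boole, ← Finset.card_powersetCard]
    congr 2
    ext S
    simp only [Finset.mem_powersetCard, Finset.mem_filter, Finset.subset_sdiff,
      Finset.disjoint_insert_right, Finset.disjoint_singleton_right]
    tauto
  calc untouchedOp α (fun A => (A.card.choose j : ℝ)) A
      = 𝔼 i : α × α, ∑ S ∈ A.powersetCard j, if i.1 ∉ S ∧ i.2 ∉ S then (1 : ℝ) else 0 :=
        Finset.expect_congr rfl fun i _ => choose_eq_sum i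
    _ = ∑ S ∈ A.powersetCard j, (1 - S.card / Fintype.card α : ℝ) ^ 2 := by
        rw [Finset.expect_sum_comm]
        simp only [expect_ite_notMem_and_notMem]
    _ = ∑ _S ∈ A.powersetCard j, (1 - j / Fintype.card α : ℝ) ^ 2 :=
        Finset.sum_congr rfl fun S hS => by rw [(Finset.mem_powersetCard.1 hS).2]
    _ = (1 - j / Fintype.card α : ℝ) ^ 2 * (A.card.choose j : ℝ) := by
        rw [Finset.sum_const, Finset.card_powersetCard, nsmul_eq_mul, mul_comm]

theorem untouchedOp_pow_choose_card [Nonempty α] (j t : ℕ) :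
    (untouchedOp α ^ t) (fun A => (A.card.choose j : ℝ))
      = (((1 - j / Fintype.card α : ℝ) ^ 2) ^ t) • fun A => (A.card.choose j : ℝ) := by
  simpa only [smul_zero, add_zero] using pow_apply_eq_of_apply_eq (m := 0)
    ((untouchedOp_choose_card (α := α) j).trans (by rw [smul_zero, add_zero])) (map_zero _) t

theorem untouchedOp_pow_le_deckOp_pow_someFixed {h : Finset α → ℝ} (h0 : h ∅ ≤ 0)
    (h1 : ∀ A, h A ≤ 1) {A C : Finset α} (hA : A ⊆ C) (t : ℕ) :
    (untouchedOp α ^ t) h A ≤ (deckOp α ^ t) (fun τ => someFixed C (locations C τ)) 1 := by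
  refine randomMapOp_pow_le_of_coupling (Equiv.refl (α × α))
    (R := fun A τ => A ⊆ C ∧ ∀ a ∈ A, τ a = a) ?_ ?_ t ⟨hA, fun a _ => Perm.one_apply a⟩
  · rintro A τ ⟨hAC, hτ⟩ ⟨l, r⟩
    refine ⟨Finset.sdiff_subset.trans hAC, fun a ha => ?_⟩
    obtain ⟨haA, hal, har⟩ : a ∈ A ∧ a ≠ l ∧ a ≠ r := by simpa using ha
    rw [Equiv.refl_apply, Perm.mul_apply, swap_apply_of_ne_of_ne hal har, hτ a haA]
  · rintro A τ ⟨hAC, hτ⟩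
    obtain rfl | ⟨a, ha⟩ := A.eq_empty_or_nonempty
    · exact h0.trans (someFixed_nonneg _ _)
    · have : someFixed C (locations C τ) = 1 :=
        if_pos ⟨⟨a, hAC ha⟩, Perm.inv_eq_iff_eq.2 (hτ a ha).symm⟩
      exact (h1 A).trans_eq this.symm

/-- Second moment bound: `1 - (1 - c * N) ^ 2 ≤ 1` for the number `N` of untouched cards. -/
theorem le_deckOp_pow_someFixed [Nonempty α] (c : ℝ) {A C : Finset α} (hA : A ⊆ C) (t : ℕ) :
    (2 * c - c ^ 2) * ((1 - 1 / Fintype.card α : ℝ) ^ 2) ^ t * A.card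
        - c ^ 2 * ((1 - 2 / Fintype.card α : ℝ) ^ 2) ^ t * (A.card * (A.card - 1))
      ≤ (deckOp α ^ t) (fun τ => someFixed C (locations C τ)) 1 := by
  have choose_expansion : (fun A : Finset α => 1 - (1 - c * A.card) ^ 2)
      = (2 * c - c ^ 2) • (fun A : Finset α => (A.card.choose 1 : ℝ))
        - (2 * c ^ 2) • fun A : Finset α => (A.card.choose 2 : ℝ) := by
    funext A
    simp only [Pi.sub_apply, Pi.smul_apply, smul_eq_mul, Nat.choose_one_right,
      Nat.cast_choose_two]
    ring
  refine le_trans (le_of_eq ?_) (untouchedOp_pow_le_deckOp_pow_someFixed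
    (h := fun A => 1 - (1 - c * A.card) ^ 2) (by simp) (fun A => by simp [sq_nonneg]) hA t)
  rw [choose_expansion, map_sub, map_smul, map_smul, untouchedOp_pow_choose_card,
    untouchedOp_pow_choose_card]
  simp only [Pi.sub_apply, Pi.smul_apply, smul_eq_mul, Nat.choose_one_right,
    Nat.cast_choose_two, Nat.cast_one, Nat.cast_ofNat]
  ring

end Untouched

section Distances

variable {n : ℕ}

theorem expectation_locationLaw (C : Finset (Fin n)) (μ : PMF (Perm (Fin n)))
    (g : (C → Fin n) → ℝ) :
    expectation (locationLaw C μ) g = expectation μ fun σ => g (locations C σ) :=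
  expectation_map _ _ _

variable [NeZero n]

theorem expectation_step (ℓ : PMF (Fin n)) (f : Perm (Fin n) → ℝ) (σ : Perm (Fin n)) :
    expectation (step ℓ σ) f = expectation ℓ fun l => 𝔼 r, f (σ * swap l r) := by
  simp only [step, expectation_bind, expectation_map, expectation_uniformOfFintype]

theorem expect_expectation_step (ℓ : PMF (Fin n)) (f : Perm (Fin n) → ℝ) :
    𝔼 σ, expectation (step ℓ σ) f = 𝔼 σ, f σ := by
  have invariant (l r : Fin n) : 𝔼 σ, f (σ * swap l r) = 𝔼 σ, f σ :=
    Fintype.expect_equiv (Equiv.mulRight (swap l r)) _ _ fun _ => rfl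
  have average (l : Fin n) : 𝔼 σ, 𝔼 r, f (σ * swap l r) = 𝔼 σ, f σ := by
    rw [Finset.expect_comm]
    simp only [invariant, Fintype.expect_const]
  simp only [expectation_step]
  simp only [expectation, Finset.expect_sum_comm, ← Finset.mul_expect, average, ← Finset.sum_mul,
    sum_toReal_eq_one, one_mul]

theorem expect_expectation_deckLaw (ℓ : ℕ → PMF (Fin n)) (f : Perm (Fin n) → ℝ) (t : ℕ) :
    𝔼 σ, expectation (deckLaw ℓ σ t) f = 𝔼 σ, f σ := by
  induction t generalizing f with
  | zero => simp only [deckLaw, expectation_pure]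
  | succ t ih => simp only [deckLaw, expectation_bind, ih, expect_expectation_step]

theorem expectation_deckLaw_randomToRandom (f : Perm (Fin n) → ℝ) (σ : Perm (Fin n)) (t : ℕ) :
    expectation (deckLaw (randomToRandom n) σ t) f = (deckOp (Fin n) ^ t) f σ := by
  induction t generalizing f with
  | zero => exact expectation_pure σ f
  | succ t ih =>
    rw [deckLaw, expectation_bind, ih, pow_succ, Module.End.mul_apply]
    congr! 1
    funext τ
    rw [expectation_step, randomToRandom, expectation_uniformOfFintype, deckOp, randomMapOp_apply,
      ← Finset.univ_product_univ, Finset.expect_product]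

theorem tvDist_le_cardDist (ℓ : ℕ → PMF (Fin n)) (C : Finset (Fin n)) (t : ℕ)
    (σ : Perm (Fin n)) :
    tvDist (locationLaw C (deckLaw ℓ σ t)) (locationLaw C (PMF.uniformOfFintype (Perm (Fin n))))
      ≤ cardDist ℓ C t :=
  le_ciSup (f := fun σ => tvDist (locationLaw C (deckLaw ℓ σ t))
    (locationLaw C (PMF.uniformOfFintype (Perm (Fin n))))) (Set.finite_range _).bddAbove σ

theorem cardDist_nonneg (ℓ : ℕ → PMF (Fin n)) (C : Finset (Fin n)) (t : ℕ) :
    0 ≤ cardDist ℓ C t :=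
  Real.iSup_nonneg fun _ => tvDist_nonneg _ _

theorem cardDist_le_one (ℓ : ℕ → PMF (Fin n)) (C : Finset (Fin n)) (t : ℕ) :
    cardDist ℓ C t ≤ 1 :=
  ciSup_le fun _ => tvDist_le_one _ _

/-- The uniform law is stationary, so it suffices to compare two initial decks. -/
theorem cardDist_le_of_forall_expectation_sub_le {ℓ : ℕ → PMF (Fin n)} {C : Finset (Fin n)}
    {t : ℕ} {B : ℝ}
    (h : ∀ g : (C → Fin n) → ℝ, (∀ x, |g x| ≤ 1) → ∀ σ σ' : Perm (Fin n),
      expectation (deckLaw ℓ σ t) (fun τ => g (locations C τ))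
        - expectation (deckLaw ℓ σ' t) (fun τ => g (locations C τ)) ≤ 2 * B) :
    cardDist ℓ C t ≤ B := by
  refine ciSup_le fun σ => tvDist_le_of_forall_expectation_sub_le fun g hg => ?_
  rw [expectation_locationLaw, expectation_locationLaw, expectation_uniformOfFintype,
    ← expect_expectation_deckLaw ℓ _ t,
    ← Fintype.expect_const (ι := Perm (Fin n)) (expectation (deckLaw ℓ σ t) _),
    ← Finset.expect_sub_distrib]
  exact Finset.expect_le Finset.univ_nonempty fun σ' _ => h g hg σ σ'

theorem cardDist_le_partialDist (ℓ : ℕ → PMF (Fin n)) (C : Finset (Fin n)) (t : ℕ) :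
    cardDist ℓ C t ≤ partialDist ℓ C.card t :=
  le_ciSup (f := fun D : {D : Finset (Fin n) // D.card = C.card} => cardDist ℓ D.1 t)
    (Set.finite_range _).bddAbove ⟨C, rfl⟩

theorem partialDist_nonneg (ℓ : ℕ → PMF (Fin n)) (k t : ℕ) : 0 ≤ partialDist ℓ k t :=
  Real.iSup_nonneg fun _ => cardDist_nonneg _ _ _

theorem partialDist_le_one (ℓ : ℕ → PMF (Fin n)) (k t : ℕ) : partialDist ℓ k t ≤ 1 :=
  Real.iSup_le (fun _ => cardDist_le_one _ _ _) zero_le_one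

end Distances

section RandomToRandom

variable {n : ℕ} [NeZero n]

theorem cardDist_singleton_le (i : Fin n) (t : ℕ) :
    cardDist (randomToRandom n) {i} t ≤ |(1 - 2 / n : ℝ)| ^ t := by
  refine cardDist_le_of_forall_expectation_sub_le fun g hg σ σ' => ?_
  have location (τ : Perm (Fin n)) : g (locations {i} τ) = g fun _ => τ⁻¹ i :=
    congrArg g (funext fun c => by rw [locations, Finset.mem_singleton.1 c.2])
  simp only [location, expectation_deckLaw_randomToRandom,
    deckOp_pow_inv_apply_card (fun u => g fun _ => u), Fintype.card_fin]
  rw [add_sub_add_right_eq_sub, ← mul_sub, mul_comm 2]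
  refine (le_abs_self _).trans ?_
  rw [abs_mul, abs_pow]
  gcongr
  exact (abs_sub _ _).trans (by linarith [hg fun _ => σ⁻¹ i, hg fun _ => σ'⁻¹ i])

theorem cardDist_le (C : Finset (Fin n)) (t : ℕ) :
    cardDist (randomToRandom n) C t ≤ 2 * C.card * (|(1 - 2 / n : ℝ)| ^ t + C.card / n) := by
  refine cardDist_le_of_forall_expectation_sub_le fun g hg σ σ' => ?_
  simp only [expectation_deckLaw_randomToRandom]
  refine (deckOp_pow_locations_sub_le hg σ σ' t).trans_eq ?_
  rw [Fintype.card_fin]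
  ring

theorem partialDist_le (k t : ℕ) :
    partialDist (randomToRandom n) k t ≤ 2 * k * (|(1 - 2 / n : ℝ)| ^ t + k / n) := by
  refine Real.iSup_le (fun C => ?_) (by positivity)
  simpa only [C.2] using cardDist_le C.1 t

theorem deckOp_pow_someFixed_sub_le_partialDist (C : Finset (Fin n)) (t : ℕ) :
    (deckOp (Fin n) ^ t) (fun τ => someFixed C (locations C τ)) 1 - C.card / n
      ≤ partialDist (randomToRandom n) C.card t := by
  have uniform := expect_someFixed_le C
  have distinguish := expectation_sub_le_tvDist
    (locationLaw C (deckLaw (randomToRandom n) 1 t))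
    (locationLaw C (PMF.uniformOfFintype (Perm (Fin n)))) (someFixed_nonneg C) (someFixed_le_one C)
  rw [Fintype.card_fin] at uniform
  rw [expectation_locationLaw, expectation_locationLaw, expectation_uniformOfFintype,
    expectation_deckLaw_randomToRandom] at distinguish
  linarith [tvDist_le_cardDist (randomToRandom n) C t 1,
    cardDist_le_partialDist (randomToRandom n) C t]

theorem pow_sub_le_partialDist {k : ℕ} (hk0 : 0 < k) (hk : k ≤ n) (t : ℕ) :
    (1 - 1 / n : ℝ) ^ (2 * t) - k / n ≤ partialDist (randomToRandom n) k t := by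
  obtain ⟨C, -, rfl⟩ := Finset.exists_subset_card_eq (s := (Finset.univ : Finset (Fin n)))
    (by simpa using hk)
  obtain ⟨c, hc⟩ := Finset.card_pos.1 hk0
  have first_moment : (1 - 1 / n : ℝ) ^ (2 * t)
      ≤ (deckOp (Fin n) ^ t) (fun τ => someFixed C (locations C τ)) 1 := by
    refine le_trans (le_of_eq ?_)
      (le_deckOp_pow_someFixed 1 (Finset.singleton_subset_iff.2 hc) t)
    rw [Fintype.card_fin, Finset.card_singleton, pow_mul]
    ring
  exact (sub_le_sub_right first_moment _).trans (deckOp_pow_someFixed_sub_le_partialDist C t)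

/-- The optimal constant in the second moment bound is the inverse of the expected number of
untouched cards among `k`. -/
theorem one_sub_le_partialDist (hn : 2 ≤ n) {k : ℕ} (hk0 : 0 < k) (hk : k ≤ n) (t : ℕ) :
    1 - 1 / (k * (1 - 1 / n : ℝ) ^ (2 * t)) - k / n ≤ partialDist (randomToRandom n) k t := by
  obtain ⟨C, -, rfl⟩ := Finset.exists_subset_card_eq (s := (Finset.univ : Finset (Fin n)))
    (by simpa using hk)
  have one_le_card : (1 : ℝ) ≤ C.card := by exact_mod_cast hk0
  have two_le_n : (2 : ℝ) ≤ n := by exact_mod_cast hn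
  set p : ℝ := (1 - 1 / n : ℝ) ^ (2 * t) with hp
  have p_pos : 0 < p := by
    have : (1 : ℝ) / n < 1 := by rw [div_lt_one] <;> linarith
    exact pow_pos (by linarith) _
  have pair_le : ((1 - 2 / n : ℝ) ^ 2) ^ t ≤ p ^ 2 := by
    have nonneg : (0 : ℝ) ≤ 1 - 2 / n := by rw [sub_nonneg, div_le_one] <;> linarith
    have square : (1 - 2 / n : ℝ) ≤ (1 - 1 / n) ^ 2 := by
      linarith [sq_nonneg (1 / n : ℝ), (by ring : (1 - 1 / n : ℝ) ^ 2 = 1 - 2 / n + (1 / n) ^ 2)]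
    rw [hp, pow_mul, pow_right_comm]
    gcongr
  have moment := le_deckOp_pow_someFixed (1 / (C.card * p)) (Finset.Subset.refl C) t
  rw [Fintype.card_fin, ← pow_mul (1 - 1 / n : ℝ), ← hp] at moment
  have pairs : (1 / (C.card * p)) ^ 2 * ((1 - 2 / n : ℝ) ^ 2) ^ t * (C.card * (C.card - 1))
      ≤ (1 / (C.card * p)) ^ 2 * p ^ 2 * (C.card * (C.card - 1)) := by
    have : (0 : ℝ) ≤ C.card * (C.card - 1) := mul_nonneg (by linarith) (by linarith)
    gcongr
  have optimum : (2 * (1 / (C.card * p)) - (1 / (C.card * p)) ^ 2) * p * C.card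
      - (1 / (C.card * p)) ^ 2 * p ^ 2 * (C.card * (C.card - 1))
      = 1 - 1 / (C.card * p) + 1 / C.card := by
    field_simp
    ring
  have := deckOp_pow_someFixed_sub_le_partialDist C t
  have : (0 : ℝ) < 1 / C.card := by positivity
  linarith

end RandomToRandom

open Real

section ExponentialBounds

theorem abs_one_sub_pow_le_exp {x : ℝ} (hx : x ≤ 1) (t : ℕ) : |1 - x| ^ t ≤ exp (-(x * t)) := by
  rw [abs_of_nonneg (sub_nonneg.2 hx)]
  calc (1 - x) ^ t ≤ exp (-x) ^ t := pow_le_pow_left₀ (sub_nonneg.2 hx) (one_sub_le_exp_neg x) t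
    _ = exp (-(x * t)) := by rw [← exp_nat_mul]; ring_nf

theorem exp_mul_one_sub_inv_le_pow {x : ℝ} (hx : 0 < x) (t : ℕ) :
    exp (t * (1 - x⁻¹)) ≤ x ^ t := by
  rw [exp_nat_mul]
  exact pow_le_pow_left₀ (exp_pos _).le
    ((le_log_iff_exp_le hx).1 (one_sub_inv_le_log_of_pos hx)) t

theorem exp_neg_div_le_pow_floor {n : ℕ} (hn : 2 ≤ n) {s S : ℝ} (hs : s ≤ S) (hS : 0 ≤ S) :
    exp (-(2 * S / (n - 1))) ≤ (1 - 1 / n : ℝ) ^ (2 * ⌊s⌋₊) := by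
  have two_le_n : (2 : ℝ) ≤ n := by exact_mod_cast hn
  have pred_pos : (0 : ℝ) < n - 1 := by linarith
  have floor_le : (⌊s⌋₊ : ℝ) ≤ S :=
    (Nat.cast_le.2 (Nat.floor_le_floor hs)).trans (Nat.floor_le hS)
  have base : (1 - 1 / n : ℝ) = (n - 1) / n := by field_simp
  refine le_trans ?_ (exp_mul_one_sub_inv_le_pow (x := 1 - 1 / n) (by rw [base]; positivity) _)
  have exponent : ((2 * ⌊s⌋₊ : ℕ) : ℝ) * (1 - (1 - 1 / n : ℝ)⁻¹) = -(2 * ⌊s⌋₊ / (n - 1)) := by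
    rw [base]
    push_cast
    field_simp
    ring
  rw [exponent]
  gcongr

end ExponentialBounds

section RealTime

theorem distAt_of_neZero (S : Shuffle) (n : ℕ) [NeZero n] (k : ℕ) (s : ℝ) :
    distAt S n k s = partialDist (S n) k ⌊s⌋₊ :=
  dif_neg (NeZero.ne n)

theorem distAt_nonneg (S : Shuffle) (n k : ℕ) (s : ℝ) : 0 ≤ distAt S n k s := by
  unfold distAt
  split_ifs with h
  · exact le_rfl
  · exact @partialDist_nonneg n ⟨h⟩ _ _ _

theorem distAt_le_one (S : Shuffle) (n k : ℕ) (s : ℝ) : distAt S n k s ≤ 1 := by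
  unfold distAt
  split_ifs with h
  · exact zero_le_one
  · exact @partialDist_le_one n ⟨h⟩ _ _ _

theorem isBoundedUnder_le_distAt (S : Shuffle) (k : ℕ → ℕ) (s : ℕ → ℝ) :
    IsBoundedUnder (· ≤ ·) atTop fun n => distAt S n (k n) (s n) :=
  isBoundedUnder_of ⟨1, fun _ => distAt_le_one _ _ _ _⟩

theorem isBoundedUnder_ge_distAt (S : Shuffle) (k : ℕ → ℕ) (s : ℕ → ℝ) :
    IsBoundedUnder (· ≥ ·) atTop fun n => distAt S n (k n) (s n) :=
  isBoundedUnder_of ⟨0, fun _ => distAt_nonneg _ _ _ _⟩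

/-- The factor `exp 2` pays for rounding the time down. -/
theorem distAt_le {n : ℕ} (hn : 2 ≤ n) (k : ℕ) (s : ℝ) :
    distAt randomToRandom n k s ≤ 2 * k * (exp 2 * exp (-(2 * s / n)) + k / n) := by
  have : NeZero n := ⟨by omega⟩
  have two_le_n : (2 : ℝ) ≤ n := by exact_mod_cast hn
  have two_div_le : (2 / n : ℝ) ≤ 1 := div_le_one_of_le₀ two_le_n (by positivity)
  have rounding : -(2 / n * ⌊s⌋₊ : ℝ) ≤ 2 + -(2 * s / n) := by
    have : (2 / n : ℝ) * s ≤ 2 / n * (⌊s⌋₊ + 1) := by gcongr; exact (Nat.lt_floor_add_one s).le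
    linarith [mul_div_right_comm 2 s (n : ℝ)]
  rw [distAt_of_neZero]
  refine (partialDist_le k _).trans ?_
  gcongr
  rw [← exp_add]
  exact (abs_one_sub_pow_le_exp two_div_le _).trans (exp_le_exp.2 rounding)

theorem distAt_zero_cards {n : ℕ} (hn : 2 ≤ n) (s : ℝ) : distAt randomToRandom n 0 s = 0 :=
  le_antisymm (by simpa only [Nat.cast_zero, mul_zero, zero_mul] using distAt_le hn 0 s)
    (distAt_nonneg _ _ _ _)

theorem exp_neg_sub_le_distAt {n k : ℕ} (hn : 2 ≤ n) (hk0 : 0 < k) (hk : k ≤ n) {s T : ℝ}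
    (hT : 0 ≤ T) (hs : s ≤ T * n) : exp (-(4 * T)) - k / n ≤ distAt randomToRandom n k s := by
  have : NeZero n := ⟨by omega⟩
  have two_le_n : (2 : ℝ) ≤ n := by exact_mod_cast hn
  have exponent : 2 * (T * n) / (n - 1) ≤ 4 * T := by
    rw [div_le_iff₀ (by linarith)]
    nlinarith
  have pow_floor := exp_neg_div_le_pow_floor hn hs (by positivity)
  rw [distAt_of_neZero]
  linarith [pow_sub_le_partialDist hk0 hk ⌊s⌋₊, exp_le_exp.2 (neg_le_neg exponent)]

theorem one_sub_exp_div_sub_le_distAt {n k : ℕ} (hn : 2 ≤ n) (hk0 : 0 < k) (hk : k ≤ n) {s : ℝ}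
    (hs : 0 ≤ s) : 1 - exp (2 * s / (n - 1)) / k - k / n ≤ distAt randomToRandom n k s := by
  have : NeZero n := ⟨by omega⟩
  have untouched : exp (-(2 * s / (n - 1))) * k ≤ k * (1 - 1 / n : ℝ) ^ (2 * ⌊s⌋₊) := by
    rw [mul_comm]
    gcongr
    exact exp_neg_div_le_pow_floor hn le_rfl hs
  have inverse := one_div_le_one_div_of_le (by positivity) untouched
  have one_div_eq : 1 / (exp (-(2 * s / (n - 1))) * k) = exp (2 * s / (n - 1)) / k := by
    rw [one_div, mul_inv, ← exp_neg, neg_neg, ← div_eq_mul_inv]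
  rw [one_div_eq] at inverse
  rw [distAt_of_neZero]
  linarith [one_sub_le_partialDist hn hk0 hk ⌊s⌋₊]

end RealTime

section Cutoff

variable {k : ℕ → ℕ}

theorem tendsto_sq_div_of_isLittleO_sqrt
    (hk : (fun n : ℕ => (k n : ℝ)) =o[atTop] fun n : ℕ => √(n : ℝ)) :
    Tendsto (fun n : ℕ => (k n : ℝ) ^ 2 / n) atTop (𝓝 0) := by
  simpa only [Real.sq_sqrt (Nat.cast_nonneg _)] using
    (hk.pow two_pos).tendsto_div_nhds_zero

theorem tendsto_div_of_isLittleO_sqrt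
    (hk : (fun n : ℕ => (k n : ℝ)) =o[atTop] fun n : ℕ => √(n : ℝ)) :
    Tendsto (fun n : ℕ => (k n : ℝ) / n) atTop (𝓝 0) := by
  refine squeeze_zero (fun n => by positivity) (fun n => ?_) (tendsto_sq_div_of_isLittleO_sqrt hk)
  gcongr
  exact_mod_cast Nat.le_self_pow two_ne_zero (k n)

theorem limsup_distAt_le (hk : (fun n : ℕ => (k n : ℝ)) =o[atTop] fun n : ℕ => √(n : ℝ))
    (htop : Tendsto k atTop atTop) (α : ℝ) :
    limsup (fun n : ℕ => distAt randomToRandom n (k n) ((1 / 2) * n * log (k n) + α * n)) atTop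
      ≤ 2 * exp 2 * exp (-(2 * α)) := by
  have hlim : Tendsto (fun n : ℕ => 2 * exp 2 * exp (-(2 * α)) + 2 * ((k n : ℝ) ^ 2 / n)) atTop
      (𝓝 (2 * exp 2 * exp (-(2 * α)))) := by
    simpa only [mul_zero, add_zero] using
      ((tendsto_sq_div_of_isLittleO_sqrt hk).const_mul 2).const_add (2 * exp 2 * exp (-(2 * α)))
  rw [← hlim.limsup_eq]
  refine limsup_le_limsup ?_ (isBoundedUnder_ge_distAt _ _ _).isCoboundedUnder_le
    hlim.isBoundedUnder_le
  filter_upwards [eventually_ge_atTop 2, htop.eventually_ge_atTop 1] with n hn hk1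
  have n_ne : (n : ℝ) ≠ 0 := by positivity
  have k_pos : (0 : ℝ) < k n := by exact_mod_cast hk1
  have exponent : -(2 * ((1 / 2) * n * log (k n) + α * n) / n) = -(2 * α) - log (k n) := by
    field_simp
    ring
  refine (distAt_le hn _ _).trans_eq ?_
  rw [exponent, exp_sub, exp_log k_pos]
  field_simp

theorem one_sub_exp_sub_le_distAt {n k : ℕ} {α : ℝ} (hn : 2 ≤ n) (hk0 : 0 < k) (hk : k ≤ n)
    (hα : α ≤ 0) (hlog : -(2 * α) ≤ log k) : 1 - exp (2 * α + 1) - k / n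
      ≤ distAt randomToRandom n k ((1 / 2) * n * log k + α * n) := by
  have two_le_n : (2 : ℝ) ≤ n := by exact_mod_cast hn
  have k_pos : (0 : ℝ) < k := by exact_mod_cast hk0
  have k_le_n : (k : ℝ) ≤ n := by exact_mod_cast hk
  have time_eq : (1 / 2) * n * log k + α * n = n / 2 * (log k + 2 * α) := by ring
  have time_nonneg : 0 ≤ (1 / 2) * n * log k + α * n := by
    rw [time_eq]
    exact mul_nonneg (by positivity) (by linarith)
  have exponent : 2 * ((1 / 2) * n * log k + α * n) / (n - 1) ≤ log k + (2 * α + 1) := by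
    rw [div_le_iff₀ (by linarith)]
    nlinarith [log_le_sub_one_of_pos k_pos]
  have survive : exp (2 * ((1 / 2) * n * log k + α * n) / (n - 1)) / k ≤ exp (2 * α + 1) := by
    rw [div_le_iff₀ k_pos]
    calc _ ≤ exp (log k + (2 * α + 1)) := exp_le_exp.2 exponent
      _ = exp (2 * α + 1) * k := by rw [exp_add, exp_log k_pos, mul_comm]
  linarith [one_sub_exp_div_sub_le_distAt hn hk0 hk time_nonneg]

theorem le_liminf_distAt (hk : (fun n : ℕ => (k n : ℝ)) =o[atTop] fun n : ℕ => √(n : ℝ))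
    (htop : Tendsto k atTop atTop) {α : ℝ} (hα : α ≤ 0) :
    1 - exp (2 * α + 1) ≤ liminf (fun n : ℕ =>
      distAt randomToRandom n (k n) ((1 / 2) * n * log (k n) + α * n)) atTop := by
  have hdiv := tendsto_div_of_isLittleO_sqrt hk
  have hlim : Tendsto (fun n : ℕ => 1 - exp (2 * α + 1) - (k n : ℝ) / n)
      atTop (𝓝 (1 - exp (2 * α + 1))) := by
    simpa only [sub_zero] using hdiv.const_sub (1 - exp (2 * α + 1))
  rw [← hlim.liminf_eq]
  refine liminf_le_liminf ?_ hlim.isBoundedUnder_ge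
    (isBoundedUnder_le_distAt _ _ _).isCoboundedUnder_ge
  have hlog : Tendsto (fun n => log (k n)) atTop atTop :=
    tendsto_log_atTop.comp (tendsto_natCast_atTop_atTop.comp htop)
  filter_upwards [eventually_ge_atTop 2, htop.eventually_ge_atTop 1, hdiv.eventually_lt_const
    one_pos, hlog.eventually_ge_atTop (-(2 * α))] with n hn hk1 hkn hL
  rw [div_lt_one (by positivity), Nat.cast_lt] at hkn
  exact one_sub_exp_sub_le_distAt hn hk1 hkn.le hα hL

theorem isLittleO_natCast_mul_log (htop : Tendsto k atTop atTop) :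
    (fun n : ℕ => (n : ℝ)) =o[atTop] fun n : ℕ => (1 / 2) * n * log (k n) := by
  have hlog : Tendsto (fun n => log (k n)) atTop atTop :=
    tendsto_log_atTop.comp (tendsto_natCast_atTop_atTop.comp htop)
  have hone : (fun _ : ℕ => (1 : ℝ)) =o[atTop] fun n => log (k n) :=
    (isLittleO_const_left_of_ne one_ne_zero).2 (tendsto_norm_atTop_atTop.comp hlog)
  have := ((isBigO_refl (fun n : ℕ => (n : ℝ)) atTop).mul_isLittleO hone).const_mul_right
    (c := (1 / 2 : ℝ)) (by norm_num)
  simpa only [mul_one, mul_assoc] using this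

theorem hasPartialCutoff_randomToRandom
    (hk : (fun n : ℕ => (k n : ℝ)) =o[atTop] fun n : ℕ => √(n : ℝ))
    (htop : Tendsto k atTop atTop) :
    HasPartialCutoff randomToRandom k (fun n : ℕ => (1 / 2) * n * log (k n))
      fun n : ℕ => (n : ℝ) where
  window := isLittleO_natCast_mul_log htop
  after := by
    have vanish : Tendsto (fun α : ℝ => 2 * exp 2 * exp (-(2 * α))) atTop (𝓝 0) := by
      simpa only [mul_zero, Function.comp_def, id_eq] using
        (tendsto_exp_neg_atTop_nhds_zero.comp (tendsto_id.const_mul_atTop two_pos)).const_mul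
          (2 * exp 2)
    refine squeeze_zero (fun α => ?_) (limsup_distAt_le hk htop) vanish
    exact le_limsup_of_frequently_le (Frequently.of_forall fun n => distAt_nonneg _ _ _ _)
      (isBoundedUnder_le_distAt _ _ _)
  before := by
    have saturate : Tendsto (fun α : ℝ => 1 - exp (2 * α + 1)) atBot (𝓝 1) := by
      have := tendsto_atBot_add_const_right _ (1 : ℝ) (tendsto_id.const_mul_atBot two_pos)
      simpa only [sub_zero, Function.comp_def, id_eq] using
        (tendsto_exp_atBot.comp this).const_sub 1
    refine tendsto_of_tendsto_of_tendsto_of_le_of_le' saturate tendsto_const_nhds ?_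
      (Eventually.of_forall fun α => ?_)
    · filter_upwards [eventually_le_atBot 0] with α hα
      exact le_liminf_distAt hk htop hα
    · exact liminf_le_of_frequently_le (Frequently.of_forall fun n => distAt_le_one _ _ _ _)
        (isBoundedUnder_ge_distAt _ _ _)

end Cutoff

section NoCutoff

theorem exists_eventually_forall_distAt_lt (K : ℕ) {ε : ℝ} (hε : 0 < ε) :
    ∃ T > (0 : ℝ), ∀ᶠ n : ℕ in atTop, ∀ k ≤ K, ∀ s ≥ T * n,
      distAt randomToRandom n k s < ε := by
  have decay : Tendsto (fun T : ℝ => 2 * K * (exp 2 * exp (-(2 * T)))) atTop (𝓝 0) := by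
    simpa only [mul_zero, Function.comp_def, id_eq] using
      ((tendsto_exp_neg_atTop_nhds_zero.comp (tendsto_id.const_mul_atTop two_pos)).const_mul
        (exp 2)).const_mul (2 * (K : ℝ))
  obtain ⟨T, hTε, hT0⟩ := ((decay.eventually_lt_const hε).and (eventually_gt_atTop 0)).exists
  have hlim : Tendsto (fun n : ℕ => 2 * K * (exp 2 * exp (-(2 * T)) + K / n)) atTop
      (𝓝 (2 * K * (exp 2 * exp (-(2 * T))))) := by
    simpa only [add_zero] using
      ((tendsto_const_div_atTop_nhds_zero_nat (K : ℝ)).const_add _).const_mul (2 * (K : ℝ))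
  refine ⟨T, hT0, ?_⟩
  filter_upwards [eventually_ge_atTop 2, hlim.eventually_lt_const hTε] with n hn hsmall k hk s hs
  have exponent : 2 * T ≤ 2 * s / n := by
    rw [le_div_iff₀ (by positivity)]
    linarith
  calc distAt randomToRandom n k s ≤ 2 * k * (exp 2 * exp (-(2 * s / n)) + k / n) :=
        distAt_le hn k s
    _ ≤ 2 * K * (exp 2 * exp (-(2 * T)) + K / n) := by gcongr
    _ < ε := hsmall

theorem exists_eventually_forall_lt_distAt (K : ℕ) {T : ℝ} (hT : 0 ≤ T) :
    ∃ δ > (0 : ℝ), ∀ᶠ n : ℕ in atTop, ∀ k ≤ K, 0 < k → ∀ s ≤ T * n,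
      δ < distAt randomToRandom n k s := by
  refine ⟨exp (-(4 * T)) / 2, by positivity, ?_⟩
  filter_upwards [eventually_ge_atTop 2, eventually_ge_atTop K,
    (tendsto_const_div_atTop_nhds_zero_nat (K : ℝ)).eventually_lt_const
      (half_pos (exp_pos (-(4 * T))))] with n hn hKn hsmall k hk hk0 s hs
  have : (k / n : ℝ) ≤ K / n := by gcongr
  linarith [exp_neg_sub_le_distAt hn hk0 (hk.trans hKn) hT hs]

theorem eventually_add_mul_le_three_mul {tmix ω : ℕ → ℝ} (h : ω =o[atTop] tmix) (α β : ℝ) :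
    ∀ᶠ n in atTop, 0 < tmix n + α * ω n → tmix n + α * ω n ≤ 3 * (tmix n + β * ω n) := by
  have small (γ : ℝ) : ∀ᶠ n in atTop, |γ * ω n| ≤ 1 / 2 * |tmix n| := by
    simpa only [Real.norm_eq_abs] using (h.const_mul_left γ).bound one_half_pos
  filter_upwards [small α, small β] with n hα hβ hpos
  have := abs_le.1 hα
  have := abs_le.1 hβ
  rcases abs_cases (tmix n) with h | h <;> linarith

theorem not_hasPartialCutoff_randomToRandom {k : ℕ → ℕ} (hk : ¬ Tendsto k atTop atTop)
    (tmix ω : ℕ → ℝ) : ¬ HasPartialCutoff randomToRandom k tmix ω := by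
  rintro ⟨hwin, hafter, hbefore⟩
  obtain ⟨K, hK⟩ : ∃ K, ∃ᶠ n in atTop, k n < K := by
    simpa only [tendsto_atTop, not_forall, not_eventually, not_le] using hk
  obtain ⟨β, hβ⟩ := (hbefore.eventually_const_lt (half_lt_self one_pos)).exists
  obtain ⟨T, hT0, hlate⟩ := exists_eventually_forall_distAt_lt K (one_half_pos (α := ℝ))
  obtain ⟨δ, hδ, hearly⟩ := exists_eventually_forall_lt_distAt K (T := 3 * T) (by positivity)
  obtain ⟨α, hα⟩ := (hafter.eventually_lt_const hδ).exists
  obtain ⟨n, hkK, hn, hβn, hαn, hlate, hearly, hratio⟩ :=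
    (hK.and_eventually ((eventually_ge_atTop 2).and
      ((eventually_lt_of_lt_liminf hβ (isBoundedUnder_ge_distAt _ _ _)).and
      ((eventually_lt_of_limsup_lt hα (isBoundedUnder_le_distAt _ _ _)).and
      (hlate.and (hearly.and (eventually_add_mul_le_three_mul hwin α β))))))).exists
  have k_pos : 0 < k n := Nat.pos_of_ne_zero fun h => by
    rw [h] at hβn
    linarith [distAt_zero_cards hn (tmix n + β * ω n)]
  have after_late : 3 * T * n < tmix n + α * ω n := lt_of_not_ge fun h =>
    (hearly _ hkK.le k_pos _ h).not_gt hαn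
  have before_late : T * n ≤ tmix n + β * ω n := by
    have : 0 < 3 * T * n := by positivity
    linarith [hratio (by linarith)]
  exact (hlate _ hkK.le _ before_late).not_gt hβn

end NoCutoff

theorem cardDist_singleton_le_exp {n : ℕ} [NeZero n] (i : Fin n) (t : ℕ) :
    cardDist (randomToRandom n) {i} t ≤ exp (-2 * t * (1 - 2 / n) / n) := by
  refine (cardDist_singleton_le i t).trans ?_
  obtain rfl | hn := (Nat.one_le_iff_ne_zero.2 (NeZero.ne n)).eq_or_lt
  · norm_num
  · have two_le_n : (2 : ℝ) ≤ n := by exact_mod_cast hn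
    refine (abs_one_sub_pow_le_exp (div_le_one_of_le₀ two_le_n (by positivity)) t).trans ?_
    rw [exp_le_exp]
    have : (0 : ℝ) ≤ 2 / n * t * (2 / n) := by positivity
    linarith [(by ring : -2 * t * (1 - 2 / n) / n = -(2 / n * t) + 2 / n * t * (2 / n : ℝ))]

theorem isLittleO_sqrt_of_isLittleO_div_log {k : ℕ → ℕ}
    (hk : (fun n : ℕ => (k n : ℝ)) =o[atTop] fun n : ℕ => ((n : ℝ) / log n) ^ (1 / 2 : ℝ)) :
    (fun n : ℕ => (k n : ℝ)) =o[atTop] fun n : ℕ => √(n : ℝ) := by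
  refine hk.trans_isBigO (IsBigO.of_bound 1 ?_)
  filter_upwards [(tendsto_log_atTop.comp tendsto_natCast_atTop_atTop).eventually_ge_atTop 1]
    with n hn
  rw [← Real.sqrt_eq_rpow, one_mul, norm_of_nonneg (sqrt_nonneg _), norm_of_nonneg (sqrt_nonneg _)]
  exact sqrt_le_sqrt (div_le_self (Nat.cast_nonneg n) hn)

end CardShuffle

theorem theorem4_general :
    (∀ k : ℕ → ℕ,
      (fun n : ℕ => (k n : ℝ)) =o[atTop] (fun n : ℕ => √(n : ℝ)) →
      Tendsto k atTop atTop →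
      CardShuffle.HasPartialCutoff CardShuffle.randomToRandom k
        (fun n : ℕ => (1 / 2) * n * Real.log (k n)) (fun n : ℕ => (n : ℝ))) ∧
    (∀ k : ℕ → ℕ, ¬ Tendsto k atTop atTop →
      ¬ ∃ tmix ω : ℕ → ℝ,
        CardShuffle.HasPartialCutoff CardShuffle.randomToRandom k tmix ω) ∧
    (∀ (n : ℕ) [NeZero n] (i : Fin n) (t : ℕ),
      CardShuffle.cardDist (CardShuffle.randomToRandom n) {i} t ≤
        Real.exp (-2 * t * (1 - 2 / n) / n)) :=
  ⟨fun _ hk htop => CardShuffle.hasPartialCutoff_randomToRandom hk htop,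
    fun _ hk ⟨tmix, ω, h⟩ => CardShuffle.not_hasPartialCutoff_randomToRandom hk tmix ω h,
    fun _ _ i t => CardShuffle.cardDist_singleton_le_exp i t⟩

theorem theorem4 :
    (∀ k : ℕ → ℕ,
      (fun n : ℕ => (k n : ℝ)) =o[atTop] (fun n : ℕ => ((n : ℝ) / Real.log n) ^ (1 / 2 : ℝ)) →
      Tendsto k atTop atTop →
      CardShuffle.HasPartialCutoff CardShuffle.randomToRandom k
        (fun n : ℕ => (1 / 2) * n * Real.log (k n)) (fun n : ℕ => (n : ℝ))) ∧
    (∀ (k : ℕ → ℕ) (K : ℕ), (∀ n, k n < K) →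
      ¬ ∃ tmix ω : ℕ → ℝ,
        CardShuffle.HasPartialCutoff CardShuffle.randomToRandom k tmix ω) ∧
    (∀ (n : ℕ) [NeZero n] (i : Fin n) (t : ℕ),
      CardShuffle.cardDist (CardShuffle.randomToRandom n) {i} t ≤
        Real.exp (-2 * t * (1 - 2 / n) / n)) :=
  ⟨fun k hk => theorem4_general.1 k (CardShuffle.isLittleO_sqrt_of_isLittleO_div_log hk),
    fun k K hK => theorem4_general.2.1 k fun h =>
      not_bddAbove_of_tendsto_atTop h ⟨K, Set.forall_mem_range.2 fun n => (hK n).le⟩,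
    theorem4_general.2.2⟩
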